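/- Let $X$ be a (real or complex) Banach space, let $\mathcal K$ with domain $\mathcal D(\mathcal K)\subseteq X$ be the (possibly unbounded) generator of a strongly continuous semigroup $(e^{t\mathcal K})_{t\ge0}$ of contractions on $X$, and suppose that for some bounded linear operator $P$ on $X$ $$\lim_{\gamma\to\infty}e^{\gamma\mathcal K}x=Px\qquad\text{for all }x\in X.$$ Let $\mathcal L$ be a bounded linear operator on $X$. Then for every $\gamma>0$ the operator $\gamma\mathcal K+\mathcal L$ with domain $\mathcal D(\mathcal K)$ generates a strongly continuous semigroup $(e^{t(\gamma\mathcal K+\mathcal L)})_{t\ge0}$, and for all $t>0$ and $x\in X$ $$\lim_{\gamma\to\infty}e^{t(\gamma\mathcal K+\mathcal L)}x=e^{tP\mathcal LP}Px.$$ Moreover, put $v_\gamma(x)=\sup_{\gamma'\ge\gamma}\|(e^{\gamma'\mathcal K}-P)x\|$ for $\gamma\ge0$ and $x\in X$. For every $t>0$ there is a constant $C\ge1$, independent of $x$, $\gamma$ and $\mathbf N$, such that for all $x\in X$, all real $\gamma\ge1$ and all sequences $\mathbf N=(N_l)_{l\ge1}$ of non-negative integers $$\left\|\left(e^{t(\gamma\mathcal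 K+\mathcal L)}-e^{tP\mathcal LP}P\right)x\right\|\le C\,v^{\sup}_\gamma(x,t\mathcal L,\mathbf N),$$ where $$v^{\sup}_\gamma(x,t\mathcal L,\mathbf N)=\sup_{l\ge1}\left(\|t\mathcal L\|^{-l+1}\,v_{N_l}\big((t\mathcal LP)^{l-1}x\big)+\frac{N_l}{\lfloor\gamma\rfloor}\|x\|\right)\in[0,\infty].$$ If $\mathcal L=0$, the first summand is read as $0$ for $l\ge2$. -/

import Mathlib

open Filter Topology
open scoped NNReal ENNReal

/-- A strongly continuous one-parameter semigroup `(T t)_{t ≥ 0}` of bounded operators. -/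
structure IsC0Semigroup {𝕜 : Type*} [RCLike 𝕜] {X : Type*} [NormedAddCommGroup X]
    [NormedSpace 𝕜 X] (T : ℝ≥0 → X →L[𝕜] X) : Prop where
  map_zero : T 0 = 1
  map_add : ∀ s t : ℝ≥0, T (s + t) = T s * T t
  strong_cont : ∀ x : X, Continuous fun t : ℝ≥0 => T t x

/-- The (possibly unbounded) operator `A`, with its domain `A.domain`, is the generator of the
strongly continuous semigroup `T`, that is `T t = exp (t A)`: a vector `x` lies in the domain of `A`
and satisfies `A x = y` exactly if `(T h x - x) / h` converges to `y` as `h` decreases to `0`. -/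
structure IsGeneratorOf {𝕜 : Type*} [RCLike 𝕜] {X : Type*} [NormedAddCommGroup X]
    [NormedSpace 𝕜 X] (A : X →ₗ.[𝕜] X) (T : ℝ≥0 → X →L[𝕜] X) : Prop where
  isC0Semigroup : IsC0Semigroup T
  mem_graph_iff : ∀ x y : X, (x, y) ∈ A.graph ↔
    Tendsto (fun h : ℝ≥0 => (((h : ℝ) : 𝕜))⁻¹ • (T h x - x)) (𝓝[>] 0) (𝓝 y)

/-- The operator `γ K + L` with domain `D(K)`, for `L` bounded. -/
noncomputable def dampedGenerator {𝕜 : Type*} [RCLike 𝕜] {X : Type*} [NormedAddCommGroup X]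
    [NormedSpace 𝕜 X] (K : X →ₗ.[𝕜] X) (L : X →L[𝕜] X) (γ : ℝ≥0) : X →ₗ.[𝕜] X :=
  (L : X →ₗ[𝕜] X) +ᵥ (((γ : ℝ) : 𝕜) • K)

/-- The mixing speed `v_γ(x) = sup_{γ' ≥ γ} ‖(T γ' - P) x‖`. -/
noncomputable def mixingSpeed {𝕜 : Type*} [RCLike 𝕜] {X : Type*} [NormedAddCommGroup X]
    [NormedSpace 𝕜 X] (T : ℝ≥0 → X →L[𝕜] X) (P : X →L[𝕜] X) (γ : ℝ≥0) (x : X) : ℝ≥0∞ :=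
  ⨆ (γ' : ℝ≥0) (_ : γ ≤ γ'), ‖(T γ' - P) x‖ₑ

/-- The quantity
`sup_{l ≥ 1} (‖A‖ ^ (-l + 1) * v_{N_l} ((A P) ^ (l - 1) x) + N_l / ⌊γ⌋ * ‖x‖)` in `[0, ∞]`.
If `A = 0`, the terms `‖A‖ ^ (-l + 1) * v_{N_l} (0)` with `l ≥ 2` are `0`, as `∞ * 0 = 0`. -/
noncomputable def dampingSpeed {𝕜 : Type*} [RCLike 𝕜] {X : Type*} [NormedAddCommGroup X]
    [NormedSpace 𝕜 X] (T : ℝ≥0 → X →L[𝕜] X) (P : X →L[𝕜] X) (γ : ℝ≥0) (x : X)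
    (A : X →L[𝕜] X) (N : ℕ → ℕ) : ℝ≥0∞ :=
  ⨆ (l : ℕ) (_ : 1 ≤ l),
    (‖A‖ₑ ^ (-(l : ℤ) + 1) * mixingSpeed T P (N l : ℝ≥0) (((A * P) ^ (l - 1)) x)
      + (N l : ℝ≥0∞) / (⌊γ⌋₊ : ℝ≥0∞) * ‖x‖ₑ)

/-!
The semigroup `S` generated by `γ K + L` is compared with `W s = exp (s P L P) P` through the
variation of constants formula. Write `T` for the time-scaled contraction semigroup `s ↦ e^(s γ K)`.

*Existence.* In the space of bounded continuous functions, with an exponential weight, the equation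
`S t = T t + ∫₀ᵗ T (t - s) L S s ds` has the form `w = w₀ + Φ w` with `‖Φ‖ < 1`, hence a solution
(`exists_satisfiesDuhamel`); uniqueness of solutions makes it a semigroup, and at `t = 0` the
integral term contributes exactly `L` to the generator (`IsGeneratorOf.exists_perturbation`).
Conversely, any semigroup generated by `γ K + L` satisfies this formula, on the domain of `K` by
differentiating `s ↦ T (t - s) (S s x)`, and everywhere by density
(`IsGeneratorOf.satisfiesDuhamel`).

*Comparison.* `P` is a projection with `T s P = P`, and `W t x = P x + ∫₀ᵗ P L W s x ds`. Therefore
the error `Δ = S x - W x` satisfies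
`Δ t = (T t - P) x + ∫₀ᵗ T (t - s) L Δ s ds + ∫₀ᵗ (T (t - s) - P) L W s x ds`.
As `L W s x = ∑ₙ sⁿ / n! (L P) ^ (n + 1) x`, the last term is at most
`∑ₙ tⁿ / n! ∫₀ᵗ ‖(T u - P) (L P) ^ (n + 1) x‖ du`, and Grönwall's inequality bounds `Δ t` by
`‖(T t - P) x‖` and such accumulated mixing errors (`SatisfiesDuhamel.norm_sub_exp_le`).

*Conclusion.* As `γ → ∞` all these terms tend to `0` by dominated convergence. For the rate, the
integrand `‖(e^(u γ K) - P) (L P) ^ n x‖` is at most `2 ‖L‖ ^ n ‖x‖` while `γ u ≤ N_{n + 1}` and at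
most `‖L‖ ^ n V` afterwards, where `V` is the damping speed; since `N_{n + 1} ‖x‖ / γ ≤ V`, every
integral is at most `‖L‖ ^ n (t + 2) V` (`mixingIntegral_scale_le`), and the exponential series
sums these bounds to a multiple of `V`.
-/

/-! ### Generators: difference quotients, scaling, bounded perturbation, density -/

section Generators

variable {𝕜 : Type*} [RCLike 𝕜] {X : Type*} [NormedAddCommGroup X] [NormedSpace 𝕜 X]

/-- A limit of difference quotients over `ℝ≥0` with scalars in `𝕜`, as in the definition of a
generator, is a one-sided limit over `ℝ` with real scalars. -/
theorem tendsto_inv_smul_nnreal_iff [NormedSpace ℝ X] [IsScalarTower ℝ 𝕜 X] (g : ℝ≥0 → X) (y : X) :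
    Tendsto (fun h : ℝ≥0 => (((h : ℝ) : 𝕜))⁻¹ • g h) (𝓝[>] 0) (𝓝 y) ↔
      Tendsto (fun h : ℝ => h⁻¹ • g h.toNNReal) (𝓝[>] 0) (𝓝 y) := by
  have hcoe : Tendsto ((↑) : ℝ≥0 → ℝ) (𝓝[>] 0) (𝓝[>] 0) := by
    refine tendsto_nhdsWithin_iff.2 ⟨?_, ?_⟩
    · exact (NNReal.continuous_coe.tendsto' 0 0 rfl).mono_left nhdsWithin_le_nhds
    · filter_upwards [self_mem_nhdsWithin] with h hh
      exact NNReal.coe_pos.2 hh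
  have hto : Tendsto Real.toNNReal (𝓝[>] 0) (𝓝[>] 0) := by
    refine tendsto_nhdsWithin_iff.2 ⟨?_, ?_⟩
    · exact (continuous_real_toNNReal.tendsto' 0 0 Real.toNNReal_zero).mono_left
        nhdsWithin_le_nhds
    · filter_upwards [self_mem_nhdsWithin] with h hh
      exact Real.toNNReal_pos.2 hh
  constructor
  · intro H
    refine (H.comp hto).congr' ?_
    filter_upwards [self_mem_nhdsWithin] with h hh
    have : (0 : ℝ) ≤ h := le_of_lt hh
    simp [Real.coe_toNNReal _ this, RCLike.real_smul_eq_coe_smul (K := 𝕜)]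
  · intro H
    refine (H.comp hcoe).congr fun h => ?_
    simp [RCLike.real_smul_eq_coe_smul (K := 𝕜)]

theorem mem_graph_vadd_iff (A : X →ₗ.[𝕜] X) (L : X →L[𝕜] X) (x y : X) :
    (x, y) ∈ ((L : X →ₗ[𝕜] X) +ᵥ A).graph ↔ (x, y - L x) ∈ A.graph := by
  simp only [LinearPMap.mem_graph_iff, LinearPMap.vadd_apply]
  constructor
  · rintro ⟨z, rfl, h⟩
    exact ⟨z, rfl, by rw [← h]; simp⟩
  · rintro ⟨z, rfl, h⟩
    exact ⟨z, rfl, by rw [h]; simp⟩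

theorem mem_graph_smul_iff (A : X →ₗ.[𝕜] X) {c : 𝕜} (hc : c ≠ 0) (x y : X) :
    (x, y) ∈ (c • A).graph ↔ (x, c⁻¹ • y) ∈ A.graph := by
  rw [LinearPMap.smul_graph]
  constructor
  · rintro ⟨⟨a, b⟩, h, he⟩
    obtain ⟨rfl, rfl⟩ := Prod.mk.inj he
    simpa [hc] using h
  · intro h
    exact ⟨_, h, by simp [hc]⟩

variable {T S : ℝ≥0 → X →L[𝕜] X} {A : X →ₗ.[𝕜] X}

theorem IsC0Semigroup.scale (hT : IsC0Semigroup T) (γ : ℝ≥0) :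
    IsC0Semigroup fun s => T (γ * s) where
  map_zero := by simpa using hT.map_zero
  map_add := fun s t => by rw [mul_add, hT.map_add]
  strong_cont := fun x => (hT.strong_cont x).comp (continuous_const.mul continuous_id)

/-- Time scaling: if `A` generates `T` then `γ A` generates `t ↦ T (γ t)`. -/
theorem IsGeneratorOf.scale (hA : IsGeneratorOf A T) {γ : ℝ≥0} (hγ : 0 < γ) :
    IsGeneratorOf (((γ : ℝ) : 𝕜) • A) (fun t => T (γ * t)) where
  isC0Semigroup := hA.isC0Semigroup.scale γ
  mem_graph_iff := fun x y => by
    have hγ' : ((γ : ℝ) : 𝕜) ≠ 0 := by simpa using hγ.ne'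
    have hmap : ∀ c : ℝ≥0, 0 < c → Tendsto (fun h : ℝ≥0 => c * h) (𝓝[>] 0) (𝓝[>] 0) := by
      intro c hc
      refine tendsto_nhdsWithin_iff.2 ⟨?_, ?_⟩
      · exact ((continuous_const.mul continuous_id).tendsto' (0 : ℝ≥0) 0 (by simp)).mono_left
          nhdsWithin_le_nhds
      · filter_upwards [self_mem_nhdsWithin] with h hh
        exact mul_pos hc hh
    rw [mem_graph_smul_iff A hγ', hA.mem_graph_iff]
    constructor
    · intro H
      have := ((H.comp (hmap γ hγ)).const_smul ((γ : ℝ) : 𝕜))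
      rw [smul_inv_smul₀ hγ'] at this
      refine this.congr fun h => ?_
      simp only [Function.comp, NNReal.coe_mul, RCLike.ofReal_mul, mul_inv, smul_smul]
      rw [mul_inv_cancel_left₀ hγ']
    · intro H
      have := ((H.comp (hmap γ⁻¹ (inv_pos.2 hγ))).const_smul ((γ : ℝ) : 𝕜)⁻¹)
      refine this.congr fun h => ?_
      simp only [Function.comp, NNReal.coe_mul, RCLike.ofReal_mul, mul_inv, smul_smul,
        NNReal.coe_inv, RCLike.ofReal_inv, inv_inv, mul_inv_cancel_left₀ hγ.ne']
      rw [inv_mul_cancel_left₀ hγ']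

theorem IsC0Semigroup.add_apply (hT : IsC0Semigroup T) (s t : ℝ≥0) (x : X) :
    T (s + t) x = T s (T t x) := by
  rw [hT.map_add]; rfl

/-- The domain of the generator is invariant under the semigroup. -/
theorem IsGeneratorOf.apply_mem_graph (hA : IsGeneratorOf A T) {x y : X} (h : (x, y) ∈ A.graph)
    (s : ℝ≥0) : (T s x, T s y) ∈ A.graph := by
  rw [hA.mem_graph_iff] at h ⊢
  refine (((T s).continuous.tendsto y).comp h).congr fun r => ?_
  simp only [Function.comp, map_smul, map_sub]
  rw [← hA.isC0Semigroup.add_apply, ← hA.isC0Semigroup.add_apply, add_comm]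

theorem IsC0Semigroup.continuous_toNNReal (hT : IsC0Semigroup T) (x : X) :
    Continuous fun s : ℝ => T s.toNNReal x :=
  (hT.strong_cont x).comp continuous_real_toNNReal

/-- A strongly continuous family of contractions is jointly continuous. -/
theorem IsC0Semigroup.continuous_uncurry (hT : IsC0Semigroup T) (hc : ∀ t, ‖T t‖ ≤ 1) :
    Continuous fun p : ℝ≥0 × X => T p.1 p.2 := by
  have : Continuous fun p : X × ℝ≥0 => T p.2 p.1 := by
    refine continuous_prod_of_continuous_lipschitzWith _ 1 (fun x => hT.strong_cont x) fun t => ?_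
    exact (T t).lipschitz.weaken (by exact_mod_cast hc t)
  exact this.comp continuous_swap

/-- The averages `h⁻¹ ∫₀ʰ T s x ds` lie in the domain of the generator and converge to `x`. -/
theorem IsGeneratorOf.dense_domain [CompleteSpace X] (hA : IsGeneratorOf A T) :
    Dense {x : X | ∃ y, (x, y) ∈ A.graph} := by
  let _ : NormedSpace ℝ X := NormedSpace.restrictScalars ℝ 𝕜 X
  have _ : IsScalarTower ℝ 𝕜 X := RestrictScalars.isScalarTower ℝ 𝕜 X
  have hT := hA.isC0Semigroup
  intro x
  set F : ℝ → X := fun r => ∫ s in (0 : ℝ)..r, T s.toNNReal x with hF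
  have hcont := hT.continuous_toNNReal x
  have hint : ∀ a b, IntervalIntegrable (fun s : ℝ => T s.toNNReal x) MeasureTheory.volume a b :=
    fun a b => hcont.intervalIntegrable a b
  have hderiv : ∀ r, HasDerivAt F (T r.toNNReal x) r := fun r =>
    intervalIntegral.integral_hasDerivAt_right (hint _ _)
      hcont.stronglyMeasurable.stronglyMeasurableAtFilter hcont.continuousAt
  have hF0 : F 0 = 0 := by simp [hF]
  have hshift : ∀ h r : ℝ, 0 ≤ h → 0 ≤ r → T r.toNNReal (F h) = F (h + r) - F r := by
    intro h r hh hr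
    have h1 : F (h + r) - F r = ∫ s in r..(h + r), T s.toNNReal x :=
      intervalIntegral.integral_interval_sub_left (hint _ _) (hint _ _)
    have h2 : ∫ s in r..(h + r), T s.toNNReal x = ∫ s in (0 : ℝ)..h, T (s + r).toNNReal x := by
      rw [intervalIntegral.integral_comp_add_right (fun s : ℝ => T s.toNNReal x)]; simp
    rw [h1, h2, hF]
    rw [← ContinuousLinearMap.intervalIntegral_comp_comm _ (hint _ _)]
    refine intervalIntegral.integral_congr fun s hs => ?_
    rw [Set.uIcc_of_le hh] at hs
    rw [Real.toNNReal_add hs.1 hr, add_comm s.toNNReal, hT.add_apply]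
  have hmem : ∀ h : ℝ, 0 < h → (F h, T h.toNNReal x - x) ∈ A.graph := by
    intro h hh
    rw [hA.mem_graph_iff, tendsto_inv_smul_nnreal_iff (𝕜 := 𝕜) (fun r => T r (F h) - F h)]
    have h1 : HasDerivAt (fun r => F (h + r) - F r) (T h.toNNReal x - x) 0 := by
      have e1 : HasDerivAt (fun r => F (h + r)) (T h.toNNReal x) 0 := by
        have := (hderiv (h + 0)).comp_const_add h 0
        simpa using this
      have e2 := hderiv 0
      rw [Real.toNNReal_zero, hT.map_zero] at e2
      exact e1.sub e2
    have h2 := (hasDerivWithinAt_iff_tendsto_slope' (s := Set.Ioi (0 : ℝ)) (by simp)).1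
      h1.hasDerivWithinAt
    refine h2.congr' ?_
    filter_upwards [self_mem_nhdsWithin] with r hr
    rw [slope_def_module, hshift h r hh.le (le_of_lt hr)]
    simp [hF0]
  have hlim : Tendsto (fun h : ℝ => h⁻¹ • F h) (𝓝[>] 0) (𝓝 x) := by
    have e2 := hderiv 0
    rw [Real.toNNReal_zero, hT.map_zero] at e2
    have h2 := (hasDerivWithinAt_iff_tendsto_slope' (s := Set.Ioi (0 : ℝ)) (by simp)).1
      e2.hasDerivWithinAt
    refine h2.congr fun r => ?_
    rw [slope_def_module]
    simp [hF0]
  refine mem_closure_of_tendsto hlim ?_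
  filter_upwards [self_mem_nhdsWithin] with h hh
  refine ⟨((h⁻¹ : ℝ) : 𝕜) • (T h.toNNReal x - x), ?_⟩
  rw [RCLike.real_smul_eq_coe_smul (K := 𝕜)]
  exact A.graph.smul_mem _ (hmem h hh)

end Generators

/-! ### Variation of constants -/

section Duhamel

variable {𝕜 : Type*} [RCLike 𝕜] {X : Type*} [NormedAddCommGroup X] [NormedSpace 𝕜 X]
  {T S : ℝ≥0 → X →L[𝕜] X} {L : X →L[𝕜] X} {A : X →ₗ.[𝕜] X}

theorem norm_apply_le_of_contraction (hc : ∀ t, ‖T t‖ ≤ 1) (t : ℝ≥0) (x : X) : ‖T t x‖ ≤ ‖x‖ := by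
  simpa using (T t).le_of_opNorm_le (hc t) x

theorem IsC0Semigroup.continuous_duhamelIntegrand (hT : IsC0Semigroup T) (hc : ∀ t, ‖T t‖ ≤ 1)
    (L : X →L[𝕜] X) {u : ℝ → X} (hu : Continuous u) :
    Continuous fun p : ℝ × ℝ => T (p.1 - p.2).toNNReal (L (u p.2)) :=
  (hT.continuous_uncurry hc).comp
    ((continuous_real_toNNReal.comp (continuous_fst.sub continuous_snd)).prodMk
      (L.continuous.comp (hu.comp continuous_snd)))

variable [NormedSpace ℝ X]

/-- The convolution `∫₀ᵗ T (t - s) L (u s) ds` of the variation of constants formula. Times are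
real numbers; `T` is only evaluated at `t - s ≥ 0` when `t ≥ 0`. -/
noncomputable def duhamelIntegral (T : ℝ≥0 → X →L[𝕜] X) (L : X →L[𝕜] X) (u : ℝ → X) (t : ℝ) : X :=
  ∫ s in (0 : ℝ)..t, T (t - s).toNNReal (L (u s))

/-- The variation of constants formula `S t = T t + ∫₀ᵗ T (t - s) L S s ds`, in the strong sense. -/
def SatisfiesDuhamel (T : ℝ≥0 → X →L[𝕜] X) (L : X →L[𝕜] X) (S : ℝ≥0 → X →L[𝕜] X) : Prop :=
  ∀ (t : ℝ≥0) (x : X), S t x = T t x + duhamelIntegral T L (fun s => S s.toNNReal x) t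

theorem IsC0Semigroup.continuous_duhamelIntegral (hT : IsC0Semigroup T) (hc : ∀ t, ‖T t‖ ≤ 1)
    (L : X →L[𝕜] X) {u : ℝ → X} (hu : Continuous u) : Continuous (duhamelIntegral T L u) :=
  intervalIntegral.continuous_parametric_intervalIntegral_of_continuous
    (f := fun t s => T (t - s).toNNReal (L (u s)))
    (hT.continuous_duhamelIntegrand hc L hu) continuous_id

theorem norm_duhamelIntegral_le (hc : ∀ t, ‖T t‖ ≤ 1)
    (L : X →L[𝕜] X) {u : ℝ → X} (hu : Continuous u) {t : ℝ} (ht : 0 ≤ t) :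
    ‖duhamelIntegral T L u t‖ ≤ ‖L‖ * ∫ s in (0 : ℝ)..t, ‖u s‖ := by
  rw [← intervalIntegral.integral_const_mul]
  refine intervalIntegral.norm_integral_le_of_norm_le ht ?_
    ((continuous_const.mul hu.norm).intervalIntegrable _ _)
  refine Eventually.of_forall fun s _ => ?_
  exact (norm_apply_le_of_contraction hc _ _).trans (L.le_opNorm _)

variable [IsScalarTower ℝ 𝕜 X]

/-- For every `x` the mean value `h⁻¹ ∫₀ʰ T (h - s) L S s x ds` tends to `L x`, so the difference
quotients of `S` and of `T` at `0` differ asymptotically by `L x`: the generator of `S`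
is the generator of `T` plus `L`. -/
theorem SatisfiesDuhamel.isGeneratorOf [CompleteSpace X] (hA : IsGeneratorOf A T) (hc : ∀ t, ‖T t‖ ≤ 1)
    (hS : IsC0Semigroup S) (hd : SatisfiesDuhamel T L S) :
    IsGeneratorOf ((L : X →ₗ[𝕜] X) +ᵥ A) S where
  isC0Semigroup := hS
  mem_graph_iff := fun x y => by
    have hT := hA.isC0Semigroup
    rw [mem_graph_vadd_iff, hA.mem_graph_iff,
      tendsto_inv_smul_nnreal_iff (𝕜 := 𝕜) (fun r => T r x - x),
      tendsto_inv_smul_nnreal_iff (𝕜 := 𝕜) (fun r => S r x - x)]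
    have hu := hS.continuous_toNNReal x
    have hlim : Tendsto (fun h : ℝ => h⁻¹ • duhamelIntegral T L (fun s => S s.toNNReal x) h)
        (𝓝[>] 0) (𝓝 (L x)) := by
      -- after the substitution `s = h σ` the mean value is a continuous function of `h`
      have hcont : Continuous fun h : ℝ =>
          ∫ σ in (0 : ℝ)..1, T (h - h * σ).toNNReal (L (S (h * σ).toNNReal x)) :=
        intervalIntegral.continuous_parametric_intervalIntegral_of_continuous
          (f := fun h σ => T (h - h * σ).toNNReal (L (S (h * σ).toNNReal x)))
          ((hT.continuous_duhamelIntegrand hc L hu).comp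
            (continuous_fst.prodMk (continuous_fst.mul continuous_snd))) continuous_const
      have h0 := (hcont.tendsto' 0 (L x) (by simp [hT.map_zero, hS.map_zero])).mono_left
        (nhdsWithin_le_nhds (s := Set.Ioi 0))
      refine h0.congr' ?_
      filter_upwards [self_mem_nhdsWithin] with h hh
      have hne : h ≠ 0 := ne_of_gt hh
      have := intervalIntegral.smul_integral_comp_mul_left (a := 0) (b := 1)
        (fun s => T (h - s).toNNReal (L (S s.toNNReal x))) h
      rw [mul_zero, mul_one] at this
      rw [duhamelIntegral, ← this, inv_smul_smul₀ hne]
    have heq : ∀ᶠ h : ℝ in 𝓝[>] 0, h⁻¹ • (S h.toNNReal x - x) = h⁻¹ • (T h.toNNReal x - x) +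
        h⁻¹ • duhamelIntegral T L (fun s => S s.toNNReal x) h := by
      filter_upwards [self_mem_nhdsWithin] with h hh
      rw [hd, Real.coe_toNNReal _ (le_of_lt hh), ← smul_add, add_sub_right_comm]
    constructor
    · intro H
      have := H.add hlim
      rw [sub_add_cancel] at this
      exact this.congr' (heq.mono fun h hh => hh.symm)
    · intro H
      refine (H.sub hlim).congr' (heq.mono fun h hh => ?_)
      rw [hh, add_sub_cancel_right]

/-- For `x` in the domain of the generator, `s ↦ T (t - s) (S s x)` has the right derivative
`T (t - s) (L (S s x))`. -/
theorem IsGeneratorOf.hasDerivWithinAt_interpolation (hA : IsGeneratorOf A T)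
    (hc : ∀ t, ‖T t‖ ≤ 1) (hS : IsGeneratorOf ((L : X →ₗ[𝕜] X) +ᵥ A) S) {x y : X}
    (hx : (x, y) ∈ A.graph) {s t : ℝ} (hs : 0 ≤ s) (hst : s < t) :
    HasDerivWithinAt (fun s : ℝ => T (t - s).toNNReal (S s.toNNReal x))
      (T (t - s).toNNReal (L (S s.toNNReal x))) (Set.Ioi s) s := by
  have hT := hA.isC0Semigroup
  set z := S s.toNNReal x with hz
  have hzmem : ∃ w, (z, w) ∈ ((L : X →ₗ[𝕜] X) +ᵥ A).graph := by
    refine ⟨_, hS.apply_mem_graph (y := y + L x) ?_ s.toNNReal⟩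
    rw [mem_graph_vadd_iff, add_sub_cancel_right]
    exact hx
  obtain ⟨w, hw⟩ := hzmem
  have hw' := (mem_graph_vadd_iff A L z w).1 hw
  rw [hA.mem_graph_iff, tendsto_inv_smul_nnreal_iff (𝕜 := 𝕜) (fun r => T r z - z)] at hw'
  rw [hS.mem_graph_iff, tendsto_inv_smul_nnreal_iff (𝕜 := 𝕜) (fun r => S r z - z)] at hw
  have hquot : Tendsto (fun h : ℝ => h⁻¹ • (S h.toNNReal z - T h.toNNReal z)) (𝓝[>] 0)
      (𝓝 (L z)) := by
    have := hw.sub hw'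
    rw [sub_sub_cancel] at this
    refine this.congr fun h => ?_
    rw [← smul_sub, sub_sub_sub_cancel_right]
  have hsub : Tendsto (fun r : ℝ => r - s) (𝓝[>] s) (𝓝[>] 0) := by
    refine tendsto_nhdsWithin_iff.2 ⟨?_, ?_⟩
    · exact ((continuous_id.sub continuous_const).tendsto' s 0 (by simp)).mono_left
        nhdsWithin_le_nhds
    · filter_upwards [self_mem_nhdsWithin] with r hr
      exact sub_pos.2 (Set.mem_Ioi.1 hr)
  rw [hasDerivWithinAt_iff_tendsto_slope' (by simp)]
  have hT1 : Tendsto (fun r : ℝ => (t - r).toNNReal) (𝓝[>] s) (𝓝 (t - s).toNNReal) :=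
    ((continuous_real_toNNReal.comp (continuous_const.sub continuous_id)).tendsto s).mono_left
      nhdsWithin_le_nhds
  have hlim := ((hT.continuous_uncurry hc).tendsto ((t - s).toNNReal, L z)).comp
    (hT1.prodMk_nhds (hquot.comp hsub))
  refine hlim.congr' ?_
  have hlt : ∀ᶠ r in 𝓝[>] s, r < t := nhdsWithin_le_nhds (Iio_mem_nhds hst)
  filter_upwards [self_mem_nhdsWithin, hlt] with r hr hrt
  have hr' : 0 ≤ r - s := (sub_pos.2 (Set.mem_Ioi.1 hr)).le
  have e1 : S r.toNNReal x = S (r - s).toNNReal z := by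
    rw [hz, ← hS.isC0Semigroup.add_apply, ← Real.toNNReal_add hr' hs, sub_add_cancel]
  have e2 : T (t - s).toNNReal z = T (t - r).toNNReal (T (r - s).toNNReal z) := by
    rw [← hT.add_apply, ← Real.toNNReal_add (sub_pos.2 hrt).le hr', sub_add_sub_cancel]
  simp only [Function.comp]
  rw [slope_def_module, e1, ← hz, e2, ← map_sub, RCLike.real_smul_eq_coe_smul (K := 𝕜), map_smul,
    RCLike.real_smul_eq_coe_smul (K := 𝕜)]

/-- The semigroup generated by a bounded perturbation satisfies the variation of constants
formula: on the domain by integrating the derivative of `s ↦ T (t - s) (S s x)`, everywhere by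
density, as the orbits of `S` are locally uniformly bounded. -/
theorem IsGeneratorOf.satisfiesDuhamel [CompleteSpace X] (hA : IsGeneratorOf A T)
    (hc : ∀ t, ‖T t‖ ≤ 1) (hS : IsGeneratorOf ((L : X →ₗ[𝕜] X) +ᵥ A) S) :
    SatisfiesDuhamel T L S := by
  have hT := hA.isC0Semigroup
  have hS0 := hS.isC0Semigroup
  intro t x
  have hu : ∀ x, Continuous fun s : ℝ => S s.toNNReal x := hS0.continuous_toNNReal
  have hint : ∀ x, IntervalIntegrable (fun s : ℝ => T ((t : ℝ) - s).toNNReal (L (S s.toNNReal x)))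
      MeasureTheory.volume 0 t := fun x =>
    ((hT.continuous_duhamelIntegrand hc L (hu x)).comp
      (continuous_const.prodMk continuous_id)).intervalIntegrable _ _
  obtain ⟨M, hM⟩ : ∃ M, ∀ s : Set.Icc (0 : ℝ) t, ‖S s.1.toNNReal‖ ≤ M := by
    refine banach_steinhaus fun x => ?_
    obtain ⟨C, hC⟩ := (isCompact_Icc (a := (0 : ℝ)) (b := t)).exists_bound_of_continuousOn
      (hu x).continuousOn
    exact ⟨C, fun s => hC s s.2⟩
  have hcont : Continuous fun x => duhamelIntegral T L (fun s => S s.toNNReal x) t := by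
    have hM0 : 0 ≤ M := (norm_nonneg _).trans (hM ⟨0, by simp⟩)
    refine (LipschitzWith.of_dist_le_mul (K := (‖L‖ * M * t).toNNReal) fun x y => ?_).continuous
    rw [Real.coe_toNNReal _ (by positivity), dist_eq_norm, dist_eq_norm, duhamelIntegral,
      duhamelIntegral, ← intervalIntegral.integral_sub (hint x) (hint y)]
    have : ∀ s ∈ Set.uIoc (0 : ℝ) t, ‖T ((t : ℝ) - s).toNNReal (L (S s.toNNReal x)) -
        T ((t : ℝ) - s).toNNReal (L (S s.toNNReal y))‖ ≤ ‖L‖ * (M * ‖x - y‖) := by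
      intro s hs
      rw [Set.uIoc_of_le t.coe_nonneg] at hs
      rw [← map_sub, ← map_sub, ← map_sub]
      refine (norm_apply_le_of_contraction hc _ _).trans ((L.le_opNorm _).trans ?_)
      gcongr
      exact (S s.toNNReal).le_of_opNorm_le (hM ⟨s, hs.1.le, hs.2⟩) _
    refine (intervalIntegral.norm_integral_le_of_norm_le_const this).trans (le_of_eq ?_)
    rw [sub_zero, abs_of_nonneg t.coe_nonneg]
    ring
  have hclosed : IsClosed {x | S t x = T t x + duhamelIntegral T L (fun s => S s.toNNReal x) t} :=
    isClosed_eq (S t).continuous ((T t).continuous.add hcont)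
  refine hclosed.closure_subset_iff.2 ?_ (hA.dense_domain x)
  rintro x ⟨y, hxy⟩
  have key := intervalIntegral.integral_eq_sub_of_hasDeriv_right (a := 0) (b := (t : ℝ))
    (f := fun s : ℝ => T ((t : ℝ) - s).toNNReal (S s.toNNReal x))
    (f' := fun s : ℝ => T ((t : ℝ) - s).toNNReal (L (S s.toNNReal x))) ?_ ?_ (hint x)
  · simp only [Set.mem_ofPred_eq, duhamelIntegral]
    rw [key]
    simp [hT.map_zero, hS0.map_zero]
  · exact ((hT.continuous_uncurry hc).comp ((continuous_real_toNNReal.comp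
      (continuous_const.sub continuous_id)).prodMk (hu x))).continuousOn
  · intro s hs
    rw [min_eq_left t.coe_nonneg, max_eq_right t.coe_nonneg] at hs
    exact hA.hasDerivWithinAt_interpolation hc hS hxy hs.1.le hs.2

end Duhamel

/-! ### Existence of the perturbed semigroup -/

/-- Grönwall's inequality in integral form. -/
theorem le_of_le_add_mul_integral {φ a : ℝ → ℝ} (hφ : Continuous φ) (ha : Continuous a)
    (ha0 : ∀ s, 0 ≤ a s) {b t : ℝ} (hb : 0 ≤ b) (ht : 0 ≤ t)
    (h : ∀ τ ∈ Set.Icc 0 t, φ τ ≤ a τ + b * ∫ s in (0 : ℝ)..τ, φ s) :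
    φ t ≤ a t + b * (Real.exp (b * t) * ∫ s in (0 : ℝ)..t, a s) := by
  have hder : ∀ (f : ℝ → ℝ), Continuous f → ∀ τ, HasDerivAt (fun τ => ∫ s in (0 : ℝ)..τ, f s)
      (f τ) τ := fun f hf τ =>
    intervalIntegral.integral_hasDerivAt_right (hf.intervalIntegrable _ _)
      hf.stronglyMeasurable.stronglyMeasurableAtFilter hf.continuousAt
  set ψ : ℝ → ℝ := fun τ => Real.exp (-(b * τ)) * (∫ s in (0 : ℝ)..τ, φ s) -
    ∫ s in (0 : ℝ)..τ, a s with hψ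
  have hψ' : ∀ τ, HasDerivAt ψ (Real.exp (-(b * τ)) * -(b * 1) * (∫ s in (0 : ℝ)..τ, φ s) +
      Real.exp (-(b * τ)) * φ τ - a τ) τ := fun τ =>
    ((((hasDerivAt_id τ).const_mul b).neg.exp).mul (hder φ hφ τ)).sub (hder a ha τ)
  have hanti : AntitoneOn ψ (Set.Icc 0 t) := by
    refine antitoneOn_of_deriv_nonpos (convex_Icc 0 t)
      (fun τ _ => (hψ' τ).continuousAt.continuousWithinAt)
      (fun τ _ => (hψ' τ).differentiableAt.differentiableWithinAt) fun τ hτ => ?_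
    have hτ' : τ ∈ Set.Icc 0 t := interior_subset hτ
    rw [(hψ' τ).deriv]
    have h1 := h τ hτ'
    have h2 : Real.exp (-(b * τ)) ≤ 1 := Real.exp_le_one_iff.2 (by nlinarith [hτ'.1])
    have h3 := mul_le_mul_of_nonneg_left h1 (Real.exp_pos (-(b * τ))).le
    have h4 := mul_le_mul_of_nonneg_right h2 (ha0 τ)
    linarith
  have h0 : ψ t ≤ ψ 0 := hanti ⟨le_rfl, ht⟩ ⟨ht, le_rfl⟩ ht
  have h1 : Real.exp (-(b * t)) * (∫ s in (0 : ℝ)..t, φ s) ≤ ∫ s in (0 : ℝ)..t, a s := by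
    simpa [hψ] using h0
  have h2 : (∫ s in (0 : ℝ)..t, φ s) ≤ Real.exp (b * t) * ∫ s in (0 : ℝ)..t, a s := by
    have := mul_le_mul_of_nonneg_left h1 (Real.exp_pos (b * t)).le
    rwa [← mul_assoc, ← Real.exp_add, add_neg_cancel, Real.exp_zero, one_mul] at this
  exact (h t ⟨ht, le_rfl⟩).trans (by gcongr)

section Existence

variable {𝕜 : Type*} [RCLike 𝕜] {X : Type*} [NormedAddCommGroup X] [NormedSpace 𝕜 X]
  {T S : ℝ≥0 → X →L[𝕜] X} {L : X →L[𝕜] X}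

theorem intervalIntegrable_duhamelIntegrand (hT : IsC0Semigroup T)
    (hc : ∀ t, ‖T t‖ ≤ 1) (L : X →L[𝕜] X) {u : ℝ → X} (hu : Continuous u) (t a b : ℝ) :
    IntervalIntegrable (fun s => T (t - s).toNNReal (L (u s))) MeasureTheory.volume a b :=
  ((hT.continuous_duhamelIntegrand hc L hu).comp
    (continuous_const.prodMk continuous_id)).intervalIntegrable _ _

variable [NormedSpace ℝ X]

theorem duhamelIntegral_add (hT : IsC0Semigroup T) (hc : ∀ t, ‖T t‖ ≤ 1)
    {u v : ℝ → X} (hu : Continuous u) (hv : Continuous v) (t : ℝ) :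
    duhamelIntegral T L (fun s => u s + v s) t = duhamelIntegral T L u t + duhamelIntegral T L v t := by
  simp only [duhamelIntegral, map_add]
  exact intervalIntegral.integral_add (intervalIntegrable_duhamelIntegrand hT hc L hu t _ _)
    (intervalIntegrable_duhamelIntegrand hT hc L hv t _ _)

theorem duhamelIntegral_sub (hT : IsC0Semigroup T) (hc : ∀ t, ‖T t‖ ≤ 1)
    {u v : ℝ → X} (hu : Continuous u) (hv : Continuous v) (t : ℝ) :
    duhamelIntegral T L (fun s => u s - v s) t = duhamelIntegral T L u t - duhamelIntegral T L v t := by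
  simp only [duhamelIntegral, map_sub]
  exact intervalIntegral.integral_sub (intervalIntegrable_duhamelIntegrand hT hc L hu t _ _)
    (intervalIntegrable_duhamelIntegrand hT hc L hv t _ _)

/-- A continuous solution of the variation of constants equation is determined by its initial
value. -/
theorem eq_of_duhamel_eq (hT : IsC0Semigroup T) (hc : ∀ t, ‖T t‖ ≤ 1)
    {u v : ℝ → X} (hu : Continuous u) (hv : Continuous v) (x : X)
    (hu' : ∀ t, 0 ≤ t → u t = T t.toNNReal x + duhamelIntegral T L u t)
    (hv' : ∀ t, 0 ≤ t → v t = T t.toNNReal x + duhamelIntegral T L v t) {t : ℝ} (ht : 0 ≤ t) :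
    u t = v t := by
  have := le_of_le_add_mul_integral (φ := fun s => ‖u s - v s‖) (a := fun _ => 0)
    (hu.sub hv).norm continuous_const (fun _ => le_rfl) (norm_nonneg L) ht fun τ hτ => by
      have e : u τ - v τ = duhamelIntegral T L (fun s => u s - v s) τ := by
        rw [duhamelIntegral_sub hT hc hu hv, hu' τ hτ.1, hv' τ hτ.1, add_sub_add_left_eq_sub]
      rw [zero_add, e]
      exact norm_duhamelIntegral_le hc L (hu.sub hv) hτ.1
  simp only [intervalIntegral.integral_zero, mul_zero, add_zero] at this
  exact sub_eq_zero.1 (norm_le_zero_iff.1 this)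

theorem duhamelIntegral_smul [IsScalarTower ℝ 𝕜 X] (c : 𝕜) (u : ℝ → X) (t : ℝ) :
    duhamelIntegral T L (fun s => c • u s) t = c • duhamelIntegral T L u t := by
  have : SMulCommClass ℝ 𝕜 X := IsScalarTower.to_smulCommClass
  simp only [duhamelIntegral, map_smul]
  exact intervalIntegral.integral_smul c _

variable [CompleteSpace X]

/-- A strongly continuous family satisfying the variation of constants formula is a semigroup, as
`t ↦ S (t + s) x` and `t ↦ S t (S s x)` solve the same equation. -/
theorem SatisfiesDuhamel.isC0Semigroup (hT : IsC0Semigroup T) (hc : ∀ t, ‖T t‖ ≤ 1)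
    (hd : SatisfiesDuhamel T L S) (hcont : ∀ x, Continuous fun t => S t x) : IsC0Semigroup S where
  strong_cont := hcont
  map_zero := by
    ext x
    rw [hd 0 x]
    simp [duhamelIntegral, hT.map_zero]
  map_add := fun t s => by
    ext x
    have hu : ∀ x, Continuous fun r : ℝ => S r.toNNReal x := fun x =>
      (hcont x).comp continuous_real_toNNReal
    have hus : Continuous fun r : ℝ => S (r.toNNReal + s) x :=
      (hcont x).comp (continuous_real_toNNReal.add continuous_const)
    have key := eq_of_duhamel_eq (L := L) hT hc hus (hu (S s x)) (S s x) (fun t ht => ?_)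
      (fun t ht => by rw [hd, Real.coe_toNNReal _ ht]) t.coe_nonneg
    · simpa using key
    · have hint := fun a b => intervalIntegrable_duhamelIntegrand hT hc L (hu x) (t + s) a b
      have e1 : ∀ r : ℝ, 0 ≤ r → S (r.toNNReal + s) x = S (r + s).toNNReal x := fun r hr => by
        rw [Real.toNNReal_add hr s.coe_nonneg, Real.toNNReal_coe]
      have e2 : duhamelIntegral T L (fun r => S (r.toNNReal + s) x) t =
          ∫ r in (s : ℝ)..(t + s), T (t + s - r).toNNReal (L (S r.toNNReal x)) := by
        have e := intervalIntegral.integral_comp_add_right (a := 0) (b := t)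
          (fun r : ℝ => T (t + s - r).toNNReal (L (S r.toNNReal x))) (s : ℝ)
        rw [zero_add] at e
        rw [← e, duhamelIntegral]
        refine intervalIntegral.integral_congr fun r hr => ?_
        rw [Set.uIcc_of_le ht] at hr
        rw [e1 r hr.1, add_sub_add_right_eq_sub]
      have e3 : T t.toNNReal (duhamelIntegral T L (fun r => S r.toNNReal x) s) =
          ∫ r in (0 : ℝ)..s, T (t + s - r).toNNReal (L (S r.toNNReal x)) := by
        rw [duhamelIntegral, ← ContinuousLinearMap.intervalIntegral_comp_comm _
          (intervalIntegrable_duhamelIntegrand hT hc L (hu x) _ _ _)]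
        refine intervalIntegral.integral_congr fun r hr => ?_
        rw [Set.uIcc_of_le s.coe_nonneg] at hr
        rw [add_sub_assoc, Real.toNNReal_add ht (sub_nonneg.2 hr.2), hT.add_apply]
      rw [e2, hd s x, map_add, e3, add_assoc,
        intervalIntegral.integral_add_adjacent_intervals (hint _ _) (hint _ _), hd,
        ← hT.add_apply, NNReal.coe_add, Real.coe_toNNReal _ ht]
      rfl

/-- The variation of constants formula has a solution. In terms of `w t = e ^ (-m t) S t x` with
`m = ‖L‖ + 1` it reads `w = w₀ + Φ w` in the space of bounded continuous functions, where
`‖Φ‖ ≤ ‖L‖ / m < 1`. -/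
theorem exists_satisfiesDuhamel [IsScalarTower ℝ 𝕜 X] (hT : IsC0Semigroup T)
    (hc : ∀ t, ‖T t‖ ≤ 1) (L : X →L[𝕜] X) :
    ∃ S : ℝ≥0 → X →L[𝕜] X, SatisfiesDuhamel T L S ∧ ∀ x, Continuous fun t => S t x := by
  have : SMulCommClass ℝ 𝕜 X := IsScalarTower.to_smulCommClass
  set m : ℝ := ‖L‖ + 1 with hm
  have hm0 : 0 < m := by positivity
  let E := BoundedContinuousFunction ℝ≥0 X
  have hu : ∀ w : E, Continuous fun s : ℝ => Real.exp (m * s) • w s.toNNReal := fun w =>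
    (Real.continuous_exp.comp (continuous_const.mul continuous_id)).smul
      (w.continuous.comp continuous_real_toNNReal)
  have hexp : ∀ t : ℝ≥0, Real.exp (-(m * t)) ≤ 1 := fun t =>
    Real.exp_le_one_iff.2 (by have := t.coe_nonneg; nlinarith)
  have hexpc : Continuous fun t : ℝ≥0 => Real.exp (-(m * t)) :=
    Real.continuous_exp.comp (continuous_const.mul NNReal.continuous_coe).neg
  have hw0 : ∀ x t, ‖Real.exp (-(m * (t : ℝ≥0))) • T t x‖ ≤ 1 * ‖x‖ := fun x t => by
    rw [norm_smul, Real.norm_of_nonneg (Real.exp_pos _).le]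
    exact mul_le_mul (hexp t) (norm_apply_le_of_contraction hc _ _) (norm_nonneg _) zero_le_one
  let W₀ : X →L[𝕜] E := LinearMap.mkContinuous
    { toFun := fun x => BoundedContinuousFunction.ofNormedAddCommGroup
        (fun t : ℝ≥0 => Real.exp (-(m * t)) • T t x) (hexpc.smul (hT.strong_cont x)) _ (hw0 x)
      map_add' := fun x y => by
        ext t
        change Real.exp _ • T t (x + y) = Real.exp _ • T t x + Real.exp _ • T t y
        rw [map_add, smul_add]
      map_smul' := fun c x => by
        ext t
        change Real.exp _ • T t (c • x) = c • Real.exp _ • T t x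
        rw [map_smul, smul_comm] } 1 fun x =>
    BoundedContinuousFunction.norm_ofNormedAddCommGroup_le _ (by positivity) (hw0 x)
  have hΦ : ∀ (w : E) (t : ℝ≥0), ‖Real.exp (-(m * t)) •
      duhamelIntegral T L (fun s => Real.exp (m * s) • w s.toNNReal) t‖ ≤ ‖L‖ / m * ‖w‖ := by
    intro w t
    rw [norm_smul, Real.norm_of_nonneg (Real.exp_pos _).le]
    have h1 : ∫ s in (0 : ℝ)..t, ‖Real.exp (m * s) • w s.toNNReal‖ ≤
        ∫ s in (0 : ℝ)..t, Real.exp (m * s) * ‖w‖ := by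
      refine intervalIntegral.integral_mono_on t.coe_nonneg
        ((hu w).norm.intervalIntegrable _ _) (Continuous.intervalIntegrable (by fun_prop) _ _)
        fun s _ => ?_
      rw [norm_smul, Real.norm_of_nonneg (Real.exp_pos _).le]
      gcongr
      exact w.norm_coe_le_norm _
    have h2 : ∫ s in (0 : ℝ)..t, Real.exp (m * s) * ‖w‖ =
        m⁻¹ * (Real.exp (m * t) - 1) * ‖w‖ := by
      rw [intervalIntegral.integral_mul_const, intervalIntegral.integral_comp_mul_left _ hm0.ne',
        integral_exp]
      simp
    have h3 := norm_duhamelIntegral_le hc L (hu w) t.coe_nonneg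
    have h4 : Real.exp (-(m * t)) * (Real.exp (m * t) - 1) ≤ 1 := by
      rw [mul_sub, ← Real.exp_add, neg_add_cancel, Real.exp_zero]
      linarith [Real.exp_pos (-(m * t))]
    calc _ ≤ Real.exp (-(m * t)) * (‖L‖ * (m⁻¹ * (Real.exp (m * t) - 1) * ‖w‖)) := by
          gcongr
          exact h3.trans (mul_le_mul_of_nonneg_left (h1.trans h2.le) (norm_nonneg _))
      _ = ‖L‖ / m * ‖w‖ * (Real.exp (-(m * t)) * (Real.exp (m * t) - 1)) := by
          rw [div_eq_mul_inv]; ring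
      _ ≤ ‖L‖ / m * ‖w‖ * 1 := by gcongr
      _ = _ := mul_one _
  let Φ : E →L[𝕜] E := LinearMap.mkContinuous
    { toFun := fun w => BoundedContinuousFunction.ofNormedAddCommGroup
        (fun t : ℝ≥0 => Real.exp (-(m * t)) •
          duhamelIntegral T L (fun s => Real.exp (m * s) • w s.toNNReal) t)
        (hexpc.smul ((hT.continuous_duhamelIntegral hc L (hu w)).comp NNReal.continuous_coe))
        _ (hΦ w)
      map_add' := fun w v => by
        ext t
        change Real.exp _ • duhamelIntegral T L (fun s => Real.exp _ • (w s.toNNReal +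
          v s.toNNReal)) t = Real.exp _ • duhamelIntegral T L _ t +
          Real.exp _ • duhamelIntegral T L _ t
        simp only [smul_add]
        rw [duhamelIntegral_add hT hc (hu w) (hu v), smul_add]
      map_smul' := fun c w => by
        ext t
        change Real.exp _ • duhamelIntegral T L (fun s => Real.exp (m * s) • c • w s.toNNReal) t =
          c • Real.exp _ • duhamelIntegral T L (fun s => Real.exp (m * s) • w s.toNNReal) t
        rw [smul_comm c, ← duhamelIntegral_smul]
        simp only [smul_comm c] } (‖L‖ / m) fun w =>
    BoundedContinuousFunction.norm_ofNormedAddCommGroup_le _ (by positivity) (hΦ w)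
  have hΦ1 : ‖Φ‖ < 1 := by
    refine (LinearMap.mkContinuous_norm_le _ (by positivity) _).trans_lt ?_
    rw [div_lt_one hm0, hm]
    linarith
  let R : E →L[𝕜] E := ((Units.oneSub Φ hΦ1)⁻¹ : (E →L[𝕜] E)ˣ)
  have hR : ∀ w : E, R w = w + Φ (R w) := by
    intro w
    have h1 : (1 - Φ) * R = 1 := (Units.oneSub Φ hΦ1).mul_inv
    have h2 : R w - Φ (R w) = w := congrArg (fun B : E →L[𝕜] E => B w) h1
    exact sub_eq_iff_eq_add.1 h2
  have hexp2 : ∀ t : ℝ, Real.exp (m * t) * Real.exp (-(m * t)) = 1 := fun t => by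
    rw [← Real.exp_add, add_neg_cancel, Real.exp_zero]
  let S : ℝ≥0 → X →L[𝕜] X := fun t => ((Real.exp (m * t) : ℝ) : 𝕜) •
    ((BoundedContinuousFunction.evalCLM 𝕜 t).comp (R.comp W₀))
  have hS : ∀ t x, S t x = Real.exp (m * t) • (R (W₀ x)) t := fun t x => by
    rw [RCLike.real_smul_eq_coe_smul (K := 𝕜)]
    rfl
  refine ⟨S, fun t x => ?_, fun x => ?_⟩
  · have e : (R (W₀ x)) t = Real.exp (-(m * t)) • T t x + Real.exp (-(m * t)) •
        duhamelIntegral T L (fun s => Real.exp (m * s) • (R (W₀ x)) s.toNNReal) t :=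
      congrArg (fun w : E => w t) (hR (W₀ x))
    rw [hS, e, ← smul_add, smul_smul, hexp2, one_smul]
    congr 1
    refine intervalIntegral.integral_congr fun s hs => ?_
    rw [Set.uIcc_of_le t.coe_nonneg] at hs
    simp only
    rw [hS, Real.coe_toNNReal _ hs.1]
  · simp only [hS]
    exact (Real.continuous_exp.comp (continuous_const.mul NNReal.continuous_coe)).smul
      (R (W₀ x)).continuous

end Existence

/-- Bounded perturbation theorem: if `A` generates a contraction semigroup and `L` is bounded, then
`A + L` generates a strongly continuous semigroup. -/
theorem IsGeneratorOf.exists_perturbation {𝕜 : Type*} [RCLike 𝕜] {X : Type*}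
    [NormedAddCommGroup X] [NormedSpace 𝕜 X] [CompleteSpace X] {A : X →ₗ.[𝕜] X}
    {T : ℝ≥0 → X →L[𝕜] X} (hA : IsGeneratorOf A T) (hc : ∀ t, ‖T t‖ ≤ 1) (L : X →L[𝕜] X) :
    ∃ S : ℝ≥0 → X →L[𝕜] X, IsGeneratorOf ((L : X →ₗ[𝕜] X) +ᵥ A) S := by
  let _ : NormedSpace ℝ X := NormedSpace.restrictScalars ℝ 𝕜 X
  have _ : IsScalarTower ℝ 𝕜 X := RestrictScalars.isScalarTower ℝ 𝕜 X
  obtain ⟨S, hd, hcont⟩ := exists_satisfiesDuhamel hA.isC0Semigroup hc L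
  exact ⟨S, hd.isGeneratorOf hA hc (hd.isC0Semigroup hA.isC0Semigroup hc hcont)⟩

/-! ### The limit projection and the limit dynamics -/

section Limit

variable {𝕜 : Type*} [RCLike 𝕜] {X : Type*} [NormedAddCommGroup X] [NormedSpace 𝕜 X]
  {T S : ℝ≥0 → X →L[𝕜] X} {L P : X →L[𝕜] X}

theorem IsC0Semigroup.apply_limit (hT : IsC0Semigroup T)
    (hP : ∀ x, Tendsto (fun γ => T γ x) atTop (𝓝 (P x))) (s : ℝ≥0) (x : X) :
    T s (P x) = P x := by
  have h1 := ((T s).continuous.tendsto (P x)).comp (hP x)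
  have h2 := (hP x).comp (tendsto_atTop_mono (fun γ => le_add_self (b := s)) tendsto_id)
  refine tendsto_nhds_unique h1 (h2.congr fun γ => ?_)
  exact hT.add_apply s γ x

theorem IsC0Semigroup.limit_mul_limit (hT : IsC0Semigroup T)
    (hP : ∀ x, Tendsto (fun γ => T γ x) atTop (𝓝 (P x))) : P * P = P := by
  ext x
  refine tendsto_nhds_unique (hP (P x)) ?_
  simp only [hT.apply_limit hP]
  exact tendsto_const_nhds

theorem norm_limit_apply_le (hc : ∀ t, ‖T t‖ ≤ 1)
    (hP : ∀ x, Tendsto (fun γ => T γ x) atTop (𝓝 (P x))) (x : X) : ‖P x‖ ≤ ‖x‖ :=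
  le_of_tendsto (hP x).norm (Eventually.of_forall fun γ => norm_apply_le_of_contraction hc γ x)

theorem norm_mul_limit_pow_apply_le (hc : ∀ t, ‖T t‖ ≤ 1)
    (hP : ∀ x, Tendsto (fun γ => T γ x) atTop (𝓝 (P x))) (n : ℕ) (x : X) :
    ‖((L * P) ^ n) x‖ ≤ ‖L‖ ^ n * ‖x‖ := by
  induction n with
  | zero => simp
  | succ n ih =>
    rw [pow_succ']
    calc ‖L (P (((L * P) ^ n) x))‖ ≤ ‖L‖ * ‖P (((L * P) ^ n) x)‖ := L.le_opNorm _
      _ ≤ ‖L‖ * (‖L‖ ^ n * ‖x‖) := by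
        gcongr
        exact (norm_limit_apply_le hc hP _).trans ih
      _ = _ := by ring

theorem norm_apply_sub_limit_le (hc : ∀ t, ‖T t‖ ≤ 1)
    (hP : ∀ x, Tendsto (fun γ => T γ x) atTop (𝓝 (P x))) (n : ℕ) (s : ℝ≥0) (x : X) :
    ‖T s (((L * P) ^ n) x) - P (((L * P) ^ n) x)‖ ≤ 2 * (‖L‖ ^ n * ‖x‖) := by
  have h := norm_mul_limit_pow_apply_le (L := L) hc hP n x
  refine (norm_sub_le _ _).trans ?_
  linarith [norm_apply_le_of_contraction hc s (((L * P) ^ n) x),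
    norm_limit_apply_le hc hP (((L * P) ^ n) x)]

theorem pow_compression_mul (hPP : P * P = P) (L : X →L[𝕜] X) (n : ℕ) :
    (P * L * P) ^ n * P = P * (L * P) ^ n := by
  induction n with
  | zero => simp
  | succ n ih =>
    rw [pow_succ', mul_assoc, ih, pow_succ' (L * P), mul_assoc (P * L) P, ← mul_assoc P P, hPP]
    simp only [mul_assoc]

/-- The limit dynamics stays in the range of `P`. -/
theorem limit_apply_exp (hPP : P * P = P) (c : 𝕜) (x : X) :
    P (NormedSpace.exp (c • (P * L * P)) (P x)) = NormedSpace.exp (c • (P * L * P)) (P x) := by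
  have h : Commute P (c • (P * L * P)) := by
    refine Commute.smul_right ?_ c
    change P * (P * L * P) = P * L * P * P
    rw [mul_assoc (P * L) P P, hPP, ← mul_assoc, ← mul_assoc, hPP]
  have h1 : P * NormedSpace.exp (c • (P * L * P)) * P = NormedSpace.exp (c • (P * L * P)) * P := by
    rw [h.exp_right.eq, mul_assoc, hPP]
  exact congrArg (fun B : X →L[𝕜] X => B x) h1

variable [CompleteSpace X]

theorem hasSum_apply_exp_compression (hPP : P * P = P) (L : X →L[𝕜] X) (c : 𝕜) (x : X) :
    HasSum (fun n : ℕ => ((n.factorial : 𝕜)⁻¹ * c ^ n) • ((L * P) ^ (n + 1)) x)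
      (L (NormedSpace.exp (c • (P * L * P)) (P x))) := by
  have h := (NormedSpace.exp_series_hasSum_exp' (𝕂 := 𝕜) (c • (P * L * P)))
  have h2 := (L.comp (ContinuousLinearMap.apply 𝕜 X (P x))).hasSum h
  refine h2.congr_fun fun n => ?_
  have e : (P * L * P) ^ n * P = P * (L * P) ^ n := pow_compression_mul hPP L n
  have e' : ((P * L * P) ^ n) (P x) = P (((L * P) ^ n) x) :=
    congrArg (fun B : X →L[𝕜] X => B x) e
  simp only [smul_pow, smul_smul, ContinuousLinearMap.comp_apply,
    ContinuousLinearMap.apply_apply, map_smul, e']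
  rw [pow_succ']
  rfl

variable [NormedSpace ℝ X] [IsScalarTower ℝ 𝕜 X]

theorem hasDerivAt_exp_compression (hPP : P * P = P) (L : X →L[𝕜] X) (x : X) (s : ℝ) :
    HasDerivAt (fun s : ℝ => NormedSpace.exp ((s : 𝕜) • (P * L * P)) (P x))
      (P (L (NormedSpace.exp ((s : 𝕜) • (P * L * P)) (P x)))) s := by
  have h1 := (hasDerivAt_exp_smul_const' (𝕂 := 𝕜) (P * L * P) (s : 𝕜))
  have h2 := (ContinuousLinearMap.apply 𝕜 X (P x)).hasFDerivAt.comp_hasDerivAt (s : 𝕜) h1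
  have h3 := (h2.hasFDerivAt.restrictScalars ℝ).comp_hasDerivAt s
    (RCLike.ofRealCLM (K := 𝕜)).hasDerivAt
  refine h3.congr_deriv ?_
  change ((RCLike.ofReal 1 : 𝕜)) • P (L (P (NormedSpace.exp ((s : 𝕜) • (P * L * P)) (P x)))) = _
  rw [limit_apply_exp hPP, RCLike.ofReal_one, one_smul]

theorem continuous_exp_compression (hPP : P * P = P) (L : X →L[𝕜] X) (x : X) :
    Continuous fun s : ℝ => NormedSpace.exp ((s : 𝕜) • (P * L * P)) (P x) :=
  continuous_iff_continuousAt.2 fun s => (hasDerivAt_exp_compression hPP L x s).continuousAt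

theorem exp_compression_eq_add_integral (hPP : P * P = P) (L : X →L[𝕜] X) (x : X) (t : ℝ) :
    NormedSpace.exp ((t : 𝕜) • (P * L * P)) (P x) = P x +
      ∫ s in (0 : ℝ)..t, P (L (NormedSpace.exp ((s : 𝕜) • (P * L * P)) (P x))) := by
  rw [intervalIntegral.integral_eq_sub_of_hasDerivAt
    (fun s _ => hasDerivAt_exp_compression hPP L x s)
    (((P.comp L).continuous.comp (continuous_exp_compression hPP L x)).intervalIntegrable _ _)]
  simp [NormedSpace.exp_zero]

end Limit

/-! ### Comparison with the limit dynamics -/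

section Comparison

variable {𝕜 : Type*} [RCLike 𝕜] {X : Type*} [NormedAddCommGroup X] [NormedSpace 𝕜 X]
  {T S : ℝ≥0 → X →L[𝕜] X} {L P : X →L[𝕜] X}

/-- The accumulated mixing error `∫₀ᵗ ‖(T u - P) y‖ du`. -/
noncomputable def mixingIntegral (T : ℝ≥0 → X →L[𝕜] X) (P : X →L[𝕜] X) (y : X) (t : ℝ) : ℝ :=
  ∫ u in (0 : ℝ)..t, ‖T u.toNNReal y - P y‖

/-- The accumulated mixing errors along the limit dynamics,
`∑ₙ tⁿ / n! ∫₀ᵗ ‖(T u - P) (L P) ^ (n + 1) x‖ du`, in accordance with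
`L exp (t P L P) P x = ∑ₙ tⁿ / n! (L P) ^ (n + 1) x`. -/
noncomputable def mixingSeries (T : ℝ≥0 → X →L[𝕜] X) (P L : X →L[𝕜] X) (x : X) (t : ℝ) : ℝ :=
  ∑' n : ℕ, t ^ n / n.factorial * mixingIntegral T P (((L * P) ^ (n + 1)) x) t

theorem IsC0Semigroup.continuous_norm_sub (hT : IsC0Semigroup T) (P : X →L[𝕜] X) (y : X) :
    Continuous fun u : ℝ => ‖T u.toNNReal y - P y‖ :=
  ((hT.continuous_toNNReal y).sub continuous_const).norm

theorem mixingIntegral_nonneg {y : X} {t : ℝ} (ht : 0 ≤ t) : 0 ≤ mixingIntegral T P y t :=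
  intervalIntegral.integral_nonneg ht fun _ _ => norm_nonneg _

theorem mixingIntegral_le_of_le (hT : IsC0Semigroup T) (hc : ∀ t, ‖T t‖ ≤ 1)
    (hP : ∀ x, Tendsto (fun γ => T γ x) atTop (𝓝 (P x))) (n : ℕ) (x : X) {t : ℝ} (ht : 0 ≤ t) :
    mixingIntegral T P (((L * P) ^ n) x) t ≤ 2 * (‖L‖ ^ n * ‖x‖) * t := by
  have := intervalIntegral.integral_mono_on ht
    ((hT.continuous_norm_sub P (((L * P) ^ n) x)).intervalIntegrable _ _)
    (intervalIntegrable_const (μ := MeasureTheory.volume) (c := 2 * (‖L‖ ^ n * ‖x‖)))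
    fun u _ => norm_apply_sub_limit_le hc hP n u.toNNReal x
  rw [intervalIntegral.integral_const, sub_zero, smul_eq_mul, mul_comm] at this
  exact this

theorem summable_pow_div_factorial_mul_pow_succ (t b c : ℝ) :
    Summable fun n : ℕ => t ^ n / n.factorial * (b ^ (n + 1) * c) := by
  refine ((Real.summable_pow_div_factorial (t * b)).mul_right (b * c)).congr fun n => ?_
  rw [mul_pow, pow_succ]
  ring

theorem summable_mixingSeries (hT : IsC0Semigroup T) (hc : ∀ t, ‖T t‖ ≤ 1)
    (hP : ∀ x, Tendsto (fun γ => T γ x) atTop (𝓝 (P x))) (L : X →L[𝕜] X) (x : X) {t : ℝ}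
    (ht : 0 ≤ t) :
    Summable fun n : ℕ => t ^ n / n.factorial * mixingIntegral T P (((L * P) ^ (n + 1)) x) t := by
  refine Summable.of_nonneg_of_le
    (fun n => mul_nonneg (by positivity) (mixingIntegral_nonneg ht)) (fun n => ?_)
    (summable_pow_div_factorial_mul_pow_succ t ‖L‖ (2 * ‖x‖ * t))
  gcongr
  exact (mixingIntegral_le_of_le hT hc hP _ x ht).trans (le_of_eq (by ring))

theorem mixingSeries_nonneg (x : X) {t : ℝ} (ht : 0 ≤ t) : 0 ≤ mixingSeries T P L x t :=
  tsum_nonneg fun _ => mul_nonneg (by positivity) (mixingIntegral_nonneg ht)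

variable [NormedSpace ℝ X] [IsScalarTower ℝ 𝕜 X] [CompleteSpace X]

/-- The source term of the error equation is bounded by expanding the limit dynamics into its
exponential series and integrating term by term. -/
theorem norm_integral_sub_limit_le (hT : IsC0Semigroup T) (hc : ∀ t, ‖T t‖ ≤ 1)
    (hP : ∀ x, Tendsto (fun γ => T γ x) atTop (𝓝 (P x))) (L : X →L[𝕜] X) (x : X) {τ t : ℝ}
    (hτ : 0 ≤ τ) (hτt : τ ≤ t) :
    ‖∫ s in (0 : ℝ)..τ,
      (T (τ - s).toNNReal - P) (L (NormedSpace.exp ((s : 𝕜) • (P * L * P)) (P x)))‖ ≤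
      mixingSeries T P L x t := by
  have ht : 0 ≤ t := hτ.trans hτt
  have hPP := hT.limit_mul_limit hP
  set y : ℕ → X := fun n => ((L * P) ^ (n + 1)) x with hy
  have hcont : ∀ n, Continuous fun s : ℝ => (s ^ n / n.factorial) •
      (T (τ - s).toNNReal (y n) - P (y n)) := fun n => by
    refine Continuous.smul (by fun_prop) (Continuous.sub ?_ continuous_const)
    exact (hT.continuous_toNNReal (y n)).comp (continuous_const.sub continuous_id)
  have hsum := intervalIntegral.hasSum_integral_of_dominated_convergence (a := 0) (b := τ)
    (μ := MeasureTheory.volume)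
    (F := fun n s => (s ^ n / n.factorial) • (T (τ - s).toNNReal (y n) - P (y n)))
    (f := fun s => (T (τ - s).toNNReal - P)
      (L (NormedSpace.exp ((s : 𝕜) • (P * L * P)) (P x))))
    (fun n _ => t ^ n / n.factorial * (‖L‖ ^ (n + 1) * (2 * ‖x‖)))
    (fun n => (hcont n).aestronglyMeasurable)
    (fun n => Eventually.of_forall fun s hs => ?_)
    (Eventually.of_forall fun s _ => summable_pow_div_factorial_mul_pow_succ _ _ _)
    intervalIntegrable_const
    (Eventually.of_forall fun s _ => ?_)
  · refine hsum.norm_le_of_bounded (summable_mixingSeries hT hc hP L x ht).hasSum fun n => ?_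
    have e1 : ∫ s in (0 : ℝ)..τ, ‖T (τ - s).toNNReal (y n) - P (y n)‖ =
        mixingIntegral T P (y n) τ := by
      rw [intervalIntegral.integral_comp_sub_left (fun s : ℝ => ‖T s.toNNReal (y n) - P (y n)‖),
        sub_self, sub_zero]
      rfl
    have hc1 := hT.continuous_norm_sub P (y n)
    have e2 : mixingIntegral T P (y n) τ ≤ mixingIntegral T P (y n) t :=
      intervalIntegral.integral_mono_interval le_rfl hτ hτt
        (Eventually.of_forall fun _ => norm_nonneg _) (hc1.intervalIntegrable _ _)
    refine le_trans ?_ (mul_le_mul_of_nonneg_left e2 (by positivity))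
    rw [← e1, ← intervalIntegral.integral_const_mul]
    refine intervalIntegral.norm_integral_le_of_norm_le hτ
      (Eventually.of_forall fun s hs => ?_)
      ((continuous_const.mul (hc1.comp (continuous_const.sub continuous_id))).intervalIntegrable
        _ _)
    have hs0 := hs.1.le
    have hst := hs.2.trans hτt
    rw [norm_smul, Real.norm_of_nonneg (by positivity)]
    gcongr
  · rw [Set.uIoc_of_le hτ] at hs
    have hs0 := hs.1.le
    have hst := hs.2.trans hτt
    rw [norm_smul, Real.norm_of_nonneg (by positivity)]
    gcongr
    exact (norm_apply_sub_limit_le hc hP (n + 1) _ x).trans (le_of_eq (by ring))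
  · have := (T (τ - s).toNNReal - P).hasSum (hasSum_apply_exp_compression hPP L (s : 𝕜) x)
    refine this.congr_fun fun n => ?_
    rw [map_smul, RCLike.real_smul_eq_coe_smul (K := 𝕜), RCLike.ofReal_div,
      RCLike.ofReal_pow, RCLike.ofReal_natCast, div_eq_inv_mul]
    rfl

/-- The master estimate. The error `Δ = S - exp (· P L P) P` solves
`Δ t = (T t - P) x + ∫₀ᵗ T (t - s) L Δ s ds + ∫₀ᵗ (T (t - s) - P) L exp (s P L P) P x ds`;
the last term is at most `mixingSeries`, and Grönwall's inequality disposes of the middle one. -/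
theorem SatisfiesDuhamel.norm_sub_exp_le (hT : IsC0Semigroup T) (hc : ∀ t, ‖T t‖ ≤ 1)
    (hP : ∀ x, Tendsto (fun γ => T γ x) atTop (𝓝 (P x))) (hS : IsC0Semigroup S)
    (hd : SatisfiesDuhamel T L S) (x : X) (t : ℝ≥0) :
    ‖S t x - NormedSpace.exp (((t : ℝ) : 𝕜) • (P * L * P)) (P x)‖ ≤
      ‖T t x - P x‖ + mixingSeries T P L x t +
        ‖L‖ * (Real.exp (‖L‖ * t) * (mixingIntegral T P x t + mixingSeries T P L x t * t)) := by
  have hPP := hT.limit_mul_limit hP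
  set c := mixingSeries T P L x t with hcdef
  have hc0 : 0 ≤ c := mixingSeries_nonneg x t.coe_nonneg
  set W : ℝ → X := fun s => NormedSpace.exp ((s : 𝕜) • (P * L * P)) (P x) with hW
  have hWc : Continuous W := continuous_exp_compression hPP L x
  have hSc : Continuous fun s : ℝ => S s.toNNReal x := hS.continuous_toNNReal x
  have hfc := hT.continuous_norm_sub P x
  have key := le_of_le_add_mul_integral (φ := fun s => ‖S s.toNNReal x - W s‖)
    (a := fun s => ‖T s.toNNReal x - P x‖ + c) (hSc.sub hWc).norm (hfc.add continuous_const)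
    (fun s => by positivity) (norm_nonneg L) t.coe_nonneg fun τ hτ => ?_
  · rw [intervalIntegral.integral_add (hfc.intervalIntegrable _ _) intervalIntegrable_const,
      intervalIntegral.integral_const, sub_zero, smul_eq_mul, mul_comm (t : ℝ) c] at key
    simp only [Real.toNNReal_coe] at key
    exact key
  · have h1 : S τ.toNNReal x = T τ.toNNReal x +
        duhamelIntegral T L (fun s => S s.toNNReal x) τ := by
      rw [hd, Real.coe_toNNReal _ hτ.1]
    have h2 : W τ = P x + ∫ s in (0 : ℝ)..τ, P (L (W s)) :=
      exp_compression_eq_add_integral hPP L x τ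
    have h3 : ∫ s in (0 : ℝ)..τ, (T (τ - s).toNNReal - P) (L (W s)) =
        duhamelIntegral T L W τ - ∫ s in (0 : ℝ)..τ, P (L (W s)) :=
      intervalIntegral.integral_sub (intervalIntegrable_duhamelIntegrand hT hc L hWc τ _ _)
        (((P.comp L).continuous.comp hWc).intervalIntegrable _ _)
    have h4 : S τ.toNNReal x - W τ = (T τ.toNNReal x - P x) +
        (∫ s in (0 : ℝ)..τ, (T (τ - s).toNNReal - P) (L (W s))) +
        duhamelIntegral T L (fun s => S s.toNNReal x - W s) τ := by
      rw [duhamelIntegral_sub hT hc hSc hWc, h3, h1, h2]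
      abel
    rw [h4]
    refine (norm_add₃_le).trans ?_
    gcongr
    · exact norm_integral_sub_limit_le hT hc hP L x hτ.1 hτ.2
    · exact norm_duhamelIntegral_le hc L (hSc.sub hWc) hτ.1

end Comparison

/-! ### Strong damping: convergence and rate -/

section Damping

variable {𝕜 : Type*} [RCLike 𝕜] {X : Type*} [NormedAddCommGroup X] [NormedSpace 𝕜 X]
  {T : ℝ≥0 → X →L[𝕜] X} {L P : X →L[𝕜] X}

theorem tendsto_apply_mul (hP : ∀ x, Tendsto (fun γ => T γ x) atTop (𝓝 (P x))) {s : ℝ≥0}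
    (hs : 0 < s) (x : X) : Tendsto (fun γ => T (γ * s) x) atTop (𝓝 (P x)) :=
  (hP x).comp (tendsto_id.atTop_mul_const hs)

theorem tendsto_apply_const_mul (hP : ∀ x, Tendsto (fun γ => T γ x) atTop (𝓝 (P x))) {γ : ℝ≥0}
    (hγ : 0 < γ) (x : X) : Tendsto (fun s => T (γ * s) x) atTop (𝓝 (P x)) :=
  (hP x).comp (tendsto_id.const_mul_atTop hγ)

theorem tendsto_mixingIntegral (hT : IsC0Semigroup T) (hc : ∀ t, ‖T t‖ ≤ 1)
    (hP : ∀ x, Tendsto (fun γ => T γ x) atTop (𝓝 (P x))) (y : X) {t : ℝ} (ht : 0 ≤ t) :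
    Tendsto (fun γ : ℝ≥0 => mixingIntegral (fun s => T (γ * s)) P y t) atTop (𝓝 0) := by
  have h := intervalIntegral.tendsto_integral_filter_of_dominated_convergence (a := 0) (b := t)
    (l := (atTop : Filter ℝ≥0)) (μ := MeasureTheory.volume)
    (F := fun γ u => ‖T (γ * u.toNNReal) y - P y‖) (f := fun _ => 0) (fun _ => 2 * ‖y‖)
    (Eventually.of_forall fun γ => ((hT.scale γ).continuous_norm_sub P y).aestronglyMeasurable)
    (Eventually.of_forall fun γ => Eventually.of_forall fun u _ => ?_) intervalIntegrable_const
    (Eventually.of_forall fun u hu => ?_)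
  · rw [intervalIntegral.integral_zero] at h
    exact h
  · rw [norm_norm]
    simpa using norm_apply_sub_limit_le (L := P) hc hP 0 (γ * u.toNNReal) y
  · rw [Set.uIoc_of_le ht] at hu
    have := ((tendsto_apply_mul hP (Real.toNNReal_pos.2 hu.1) y).sub_const (P y)).norm
    simpa using this

theorem tendsto_mixingSeries (hT : IsC0Semigroup T) (hc : ∀ t, ‖T t‖ ≤ 1)
    (hP : ∀ x, Tendsto (fun γ => T γ x) atTop (𝓝 (P x))) (L : X →L[𝕜] X) (x : X) {t : ℝ}
    (ht : 0 ≤ t) :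
    Tendsto (fun γ : ℝ≥0 => mixingSeries (fun s => T (γ * s)) P L x t) atTop (𝓝 0) := by
  have h := tendsto_tsum_of_dominated_convergence (𝓕 := (atTop : Filter ℝ≥0))
    (f := fun γ n => t ^ n / n.factorial *
      mixingIntegral (fun s => T (γ * s)) P (((L * P) ^ (n + 1)) x) t) (g := fun _ => 0)
    (summable_pow_div_factorial_mul_pow_succ t ‖L‖ (2 * ‖x‖ * t)) (fun n => ?_) ?_
  · rw [tsum_zero] at h
    exact h
  · simpa using (tendsto_mixingIntegral hT hc hP (((L * P) ^ (n + 1)) x) ht).const_mul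
      (t ^ n / n.factorial)
  · filter_upwards [eventually_gt_atTop 0] with γ hγ n
    rw [Real.norm_of_nonneg (mul_nonneg (by positivity) (mixingIntegral_nonneg ht))]
    gcongr
    exact (mixingIntegral_le_of_le (hT.scale γ) (fun s => hc (γ * s))
      (tendsto_apply_const_mul hP hγ) _ x ht).trans (le_of_eq (by ring))

/-- The powers of `‖t L‖` and of `t` in the damping speed cancel: beyond time `N (n + 1)` the vector
`(L P) ^ n x` mixes up to `‖L‖ ^ n` times the damping speed. -/
theorem enorm_apply_sub_le_dampingSpeed (T : ℝ≥0 → X →L[𝕜] X) (P L : X →L[𝕜] X) {t : ℝ≥0}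
    (ht : 0 < t) (γ : ℝ≥0) (x : X) (N : ℕ → ℕ) (n : ℕ) {r : ℝ≥0} (hr : (N (n + 1) : ℝ≥0) ≤ r) :
    ‖T r (((L * P) ^ n) x) - P (((L * P) ^ n) x)‖ₑ ≤
      ‖L‖ₑ ^ n * dampingSpeed T P γ x (((t : ℝ) : 𝕜) • L) N := by
  set V := dampingSpeed T P γ x (((t : ℝ) : 𝕜) • L) N with hV
  set q := ‖T r (((L * P) ^ n) x) - P (((L * P) ^ n) x)‖ₑ with hq
  rcases eq_or_ne ‖L‖ₑ 0 with hL | hL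
  · rcases n with _ | n
    · have h1 : q ≤ mixingSpeed T P (N 1 : ℝ≥0) x :=
        le_iSup₂_of_le (f := fun (γ' : ℝ≥0) (_ : (N 1 : ℝ≥0) ≤ γ') => ‖(T γ' - P) x‖ₑ) r hr le_rfl
      have h2 : mixingSpeed T P (N 1 : ℝ≥0) x ≤ V := by
        rw [hV, dampingSpeed]
        refine le_iSup₂_of_le 1 le_rfl ?_
        simp
      simpa using h1.trans h2
    · have : L = 0 := by
        rw [← ofReal_norm, ENNReal.ofReal_eq_zero] at hL
        exact norm_le_zero_iff.1 hL
      simp [hq, this]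
  · set τ : ℝ≥0∞ := ‖((t : ℝ) : 𝕜)‖ₑ with hτ
    have hτ0 : τ ≠ 0 := by
      rw [hτ, Ne, enorm_eq_zero]
      simpa using ht.ne'
    have hτtop : τ ≠ ⊤ := enorm_ne_top
    have hA : ‖((t : ℝ) : 𝕜) • L‖ₑ = τ * ‖L‖ₑ := enorm_smul _ _
    have h1 : τ ^ n * q ≤ mixingSpeed T P (N (n + 1) : ℝ≥0)
        ((((((t : ℝ) : 𝕜) • L) * P) ^ n) x) := by
      refine le_iSup₂_of_le (f := fun (γ' : ℝ≥0) (_ : (N (n + 1) : ℝ≥0) ≤ γ') =>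
        ‖(T γ' - P) ((((((t : ℝ) : 𝕜) • L) * P) ^ n) x)‖ₑ) r hr ?_
      have e : ((((((t : ℝ) : 𝕜) • L) * P) ^ n) x) = ((t : ℝ) : 𝕜) ^ n • ((L * P) ^ n) x := by
        rw [smul_mul_assoc, smul_pow]
        rfl
      rw [e, map_smul, enorm_smul, enorm_pow]
      rfl
    have h2 : (τ * ‖L‖ₑ) ^ (-((n + 1 : ℕ) : ℤ) + 1) * (τ ^ n * q) ≤ V := by
      rw [hV, dampingSpeed, ← hA]
      refine le_iSup₂_of_le (n + 1) (by omega) (le_add_right ?_)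
      rw [Nat.add_sub_cancel]
      gcongr
    have ha0 : (τ * ‖L‖ₑ) ^ n ≠ 0 := pow_ne_zero _ (mul_ne_zero hτ0 hL)
    have hatop : (τ * ‖L‖ₑ) ^ n ≠ ⊤ := ENNReal.pow_ne_top (ENNReal.mul_ne_top hτtop enorm_ne_top)
    have e : (τ * ‖L‖ₑ) ^ (-((n + 1 : ℕ) : ℤ) + 1) = ((τ * ‖L‖ₑ) ^ n)⁻¹ := by
      have : (-((n + 1 : ℕ) : ℤ) + 1) = -(n : ℤ) := by push_cast; ring
      rw [this, ENNReal.zpow_neg, zpow_natCast]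
    rw [e, ← ENNReal.div_eq_inv_mul, ENNReal.div_le_iff ha0 hatop, mul_pow, mul_comm V,
      mul_assoc] at h2
    exact (ENNReal.mul_le_mul_iff_right (pow_ne_zero _ hτ0) (ENNReal.pow_ne_top hτtop)).1 h2

theorem natCast_mul_enorm_le_dampingSpeed (T : ℝ≥0 → X →L[𝕜] X) (P A : X →L[𝕜] X) {γ : ℝ≥0}
    (hγ : 1 ≤ γ) (x : X) (N : ℕ → ℕ) (n : ℕ) :
    (N (n + 1) : ℝ≥0∞) * ‖x‖ₑ ≤ γ * dampingSpeed T P γ x A N := by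
  have h1 : (N (n + 1) : ℝ≥0∞) / (⌊γ⌋₊ : ℝ≥0∞) * ‖x‖ₑ ≤ dampingSpeed T P γ x A N := by
    rw [dampingSpeed]
    exact le_iSup₂_of_le (n + 1) (by omega) le_add_self
  have hfloor : (⌊γ⌋₊ : ℝ≥0∞) ≤ γ := by exact_mod_cast Nat.floor_le (zero_le (a := γ))
  have hpos : (⌊γ⌋₊ : ℝ≥0∞) ≠ 0 := by
    have := (Nat.floor_pos (a := γ)).2 hγ
    exact_mod_cast this.ne'
  calc (N (n + 1) : ℝ≥0∞) * ‖x‖ₑ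
      = (⌊γ⌋₊ : ℝ≥0∞) * ((N (n + 1) : ℝ≥0∞) / (⌊γ⌋₊ : ℝ≥0∞) * ‖x‖ₑ) := by
        rw [← mul_assoc, ENNReal.mul_div_cancel hpos (ENNReal.natCast_ne_top _)]
    _ ≤ γ * dampingSpeed T P γ x A N := mul_le_mul' hfloor h1

/-- Up to time `N / γ` the mixing error is only bounded by `2 ‖L‖ ^ n ‖x‖`, afterwards it is at most
`‖L‖ ^ n v`; with `N ‖x‖ ≤ γ v` both phases contribute a multiple of `v`. -/
theorem mixingIntegral_scale_le (hT : IsC0Semigroup T) (hc : ∀ t, ‖T t‖ ≤ 1)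
    (hP : ∀ x, Tendsto (fun γ => T γ x) atTop (𝓝 (P x))) {γ : ℝ≥0} (hγ : 0 < γ) (x : X) (n N : ℕ)
    {v : ℝ} (hv : 0 ≤ v)
    (h1 : ∀ r : ℝ≥0, (N : ℝ≥0) ≤ r →
      ‖T r (((L * P) ^ n) x) - P (((L * P) ^ n) x)‖ ≤ ‖L‖ ^ n * v)
    (h2 : N * ‖x‖ ≤ γ * v) {t : ℝ} (ht : 0 ≤ t) :
    mixingIntegral (fun s => T (γ * s)) P (((L * P) ^ n) x) t ≤ ‖L‖ ^ n * ((t + 2) * v) := by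
  set y := ((L * P) ^ n) x with hy
  have hγ' : (0 : ℝ) < γ := hγ
  have hcont := (hT.scale γ).continuous_norm_sub P y
  set δ : ℝ := min t (N / γ) with hδ
  have hδ0 : 0 ≤ δ := le_min ht (by positivity)
  have hδt : δ ≤ t := min_le_left _ _
  have hb : ∀ u : ℝ, ‖T (γ * u.toNNReal) y - P y‖ ≤ 2 * (‖L‖ ^ n * ‖x‖) := fun u =>
    norm_apply_sub_limit_le hc hP n _ x
  have i1 : ∫ u in (0 : ℝ)..δ, ‖T (γ * u.toNNReal) y - P y‖ ≤ 2 * (‖L‖ ^ n * v) := by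
    have := intervalIntegral.norm_integral_le_of_norm_le_const (a := 0) (b := δ)
      (f := fun u : ℝ => ‖T (γ * u.toNNReal) y - P y‖) fun u _ => by
        rw [norm_norm]; exact hb u
    rw [sub_zero, abs_of_nonneg hδ0] at this
    refine (le_abs_self _).trans (this.trans ?_)
    have h3 : δ * ‖x‖ ≤ v := by
      calc δ * ‖x‖ ≤ N / γ * ‖x‖ := by gcongr; exact min_le_right _ _
        _ = (N * ‖x‖) / γ := by ring
        _ ≤ v := by rwa [div_le_iff₀' hγ']
    calc 2 * (‖L‖ ^ n * ‖x‖) * δ = 2 * (‖L‖ ^ n * (δ * ‖x‖)) := by ring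
      _ ≤ _ := by gcongr
  have i2 : ∫ u in δ..t, ‖T (γ * u.toNNReal) y - P y‖ ≤ ‖L‖ ^ n * v * t := by
    have := intervalIntegral.norm_integral_le_of_norm_le_const (a := δ) (b := t)
      (f := fun u : ℝ => ‖T (γ * u.toNNReal) y - P y‖) (C := ‖L‖ ^ n * v) fun u hu => by
        rw [Set.uIoc_of_le hδt] at hu
        rw [norm_norm]
        refine h1 _ ?_
        have hu0 : (0 : ℝ) ≤ u := hδ0.trans hu.1.le
        have h4 : N / γ < u := by
          rcases min_lt_iff.1 hu.1 with h | h
          · exact absurd hu.2 (not_le.2 h)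
          · exact h
        rw [← NNReal.coe_le_coe, NNReal.coe_mul, Real.coe_toNNReal _ hu0]
        rw [div_lt_iff₀' hγ'] at h4
        exact_mod_cast h4.le
    rw [abs_of_nonneg (sub_nonneg.2 hδt)] at this
    refine (le_abs_self _).trans (this.trans ?_)
    gcongr
    linarith
  calc mixingIntegral (fun s => T (γ * s)) P y t
      = (∫ u in (0 : ℝ)..δ, ‖T (γ * u.toNNReal) y - P y‖) +
          ∫ u in δ..t, ‖T (γ * u.toNNReal) y - P y‖ :=
        (intervalIntegral.integral_add_adjacent_intervals (hcont.intervalIntegrable _ _)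
          (hcont.intervalIntegrable _ _)).symm
    _ ≤ 2 * (‖L‖ ^ n * v) + ‖L‖ ^ n * v * t := add_le_add i1 i2
    _ = _ := by ring

/-- At the fixed time `t > 0` the mixing error is at most `v` if `γ t ≥ N`; otherwise
`t ‖x‖ ≤ N ‖x‖ / γ ≤ v`. -/
theorem norm_apply_mul_sub_limit_le (hc : ∀ t, ‖T t‖ ≤ 1)
    (hP : ∀ x, Tendsto (fun γ => T γ x) atTop (𝓝 (P x))) {γ : ℝ≥0} (hγ : 0 < γ) (x : X) (N : ℕ)
    {v : ℝ} (hv : 0 ≤ v) (h1 : ∀ r : ℝ≥0, (N : ℝ≥0) ≤ r → ‖T r x - P x‖ ≤ v)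
    (h2 : N * ‖x‖ ≤ γ * v) {t : ℝ≥0} (ht : 0 < t) :
    ‖T (γ * t) x - P x‖ ≤ (1 + 2 / t) * v := by
  have ht' : (0 : ℝ) < t := ht
  have hγ' : (0 : ℝ) < γ := hγ
  rcases le_total (N : ℝ≥0) (γ * t) with h | h
  · refine (h1 _ h).trans (le_mul_of_one_le_left hv ?_)
    have : 0 ≤ 2 / (t : ℝ) := by positivity
    linarith
  · have h3 : ‖T (γ * t) x - P x‖ ≤ 2 * ‖x‖ := by
      simpa using norm_apply_sub_limit_le (L := P) hc hP 0 (γ * t) x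
    have h' : (γ : ℝ) * t ≤ N := by exact_mod_cast h
    have h4 : (γ : ℝ) * (t * ‖x‖) ≤ γ * v := by
      rw [← mul_assoc]
      exact (mul_le_mul_of_nonneg_right h' (norm_nonneg x)).trans h2
    have h5 : ‖x‖ ≤ v / t := by
      rw [le_div_iff₀' ht']
      exact le_of_mul_le_mul_left h4 hγ'
    calc ‖T (γ * t) x - P x‖ ≤ 2 * (v / t) := by linarith
      _ = 2 / t * v := by ring
      _ ≤ _ := by gcongr; linarith

end Damping

theorem mainTheorem3 {𝕜 : Type*} [RCLike 𝕜] {X : Type*} [NormedAddCommGroup X]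
    [NormedSpace 𝕜 X] [CompleteSpace X]
    (K : X →ₗ.[𝕜] X) (T : ℝ≥0 → X →L[𝕜] X) (hK : IsGeneratorOf K T)
    (hT : ∀ t : ℝ≥0, ‖T t‖ ≤ 1)
    (P : X →L[𝕜] X) (hP : ∀ x : X, Tendsto (fun γ : ℝ≥0 => T γ x) atTop (𝓝 (P x)))
    (L : X →L[𝕜] X) :
    (∀ γ : ℝ≥0, 0 < γ →
      ∃ S : ℝ≥0 → X →L[𝕜] X, IsGeneratorOf (dampedGenerator K L γ) S) ∧
    ∀ S : ℝ≥0 → ℝ≥0 → X →L[𝕜] X,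
      (∀ γ : ℝ≥0, 0 < γ → IsGeneratorOf (dampedGenerator K L γ) (S γ)) →
      ∀ t : ℝ≥0, 0 < t →
        (∀ x : X, Tendsto (fun γ : ℝ≥0 => S γ t x) atTop
          (𝓝 (NormedSpace.exp (((t : ℝ) : 𝕜) • (P * L * P)) (P x)))) ∧
        ∃ C : ℝ≥0, 1 ≤ C ∧ ∀ (x : X) (γ : ℝ≥0) (N : ℕ → ℕ), 1 ≤ γ →
          ‖(S γ t - NormedSpace.exp (((t : ℝ) : 𝕜) • (P * L * P)) * P) x‖ₑ ≤
            (C : ℝ≥0∞) * dampingSpeed T P γ x (((t : ℝ) : 𝕜) • L) N := by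
  have hT0 := hK.isC0Semigroup
  refine ⟨fun γ hγ => (hK.scale hγ).exists_perturbation (fun s => hT (γ * s)) L,
    fun S hS t ht => ?_⟩
  let _ : NormedSpace ℝ X := NormedSpace.restrictScalars ℝ 𝕜 X
  have _ : IsScalarTower ℝ 𝕜 X := RestrictScalars.isScalarTower ℝ 𝕜 X
  have ht' : (0 : ℝ) < t := ht
  have master : ∀ γ : ℝ≥0, 0 < γ → ∀ x : X,
      ‖S γ t x - NormedSpace.exp (((t : ℝ) : 𝕜) • (P * L * P)) (P x)‖ ≤
      ‖T (γ * t) x - P x‖ + mixingSeries (fun s => T (γ * s)) P L x t +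
        ‖L‖ * (Real.exp (‖L‖ * t) * (mixingIntegral (fun s => T (γ * s)) P x t +
          mixingSeries (fun s => T (γ * s)) P L x t * t)) := fun γ hγ x =>
    ((hK.scale hγ).satisfiesDuhamel (fun s => hT (γ * s)) (hS γ hγ)).norm_sub_exp_le
      (hT0.scale γ) (fun s => hT (γ * s)) (tendsto_apply_const_mul hP hγ)
      (hS γ hγ).isC0Semigroup x t
  constructor
  · intro x
    rw [tendsto_iff_norm_sub_tendsto_zero]
    have l1 : Tendsto (fun γ : ℝ≥0 => ‖T (γ * t) x - P x‖) atTop (𝓝 0) :=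
      tendsto_iff_norm_sub_tendsto_zero.1 (tendsto_apply_mul hP ht x)
    have l2 := tendsto_mixingSeries hT0 hT hP L x t.coe_nonneg
    have l3 := tendsto_mixingIntegral hT0 hT hP x t.coe_nonneg
    have l4 := (l1.add l2).add
      (((l3.add (l2.mul_const (t : ℝ))).const_mul (Real.exp (‖L‖ * t))).const_mul ‖L‖)
    simp only [zero_mul, mul_zero, add_zero] at l4
    refine tendsto_of_tendsto_of_tendsto_of_le_of_le' tendsto_const_nhds l4
      (Eventually.of_forall fun γ => norm_nonneg _) ?_
    filter_upwards [eventually_gt_atTop 0] with γ hγ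
    exact master γ hγ x
  · have hsum := summable_pow_div_factorial_mul_pow_succ (t : ℝ) ‖L‖ ((t : ℝ) + 2)
    set κ : ℝ := ∑' n : ℕ, (t : ℝ) ^ n / n.factorial * (‖L‖ ^ (n + 1) * ((t : ℝ) + 2)) with hκ
    have hκ0 : 0 ≤ κ := tsum_nonneg fun n => by positivity
    set c : ℝ := (1 + 2 / t) + κ + ‖L‖ * (Real.exp (‖L‖ * t) * ((t + 2) + κ * t)) with hc
    have hc1 : 1 ≤ c := by
      have e1 : 0 ≤ 2 / (t : ℝ) := by positivity
      have e2 : 0 ≤ ‖L‖ * (Real.exp (‖L‖ * t) * (((t : ℝ) + 2) + κ * t)) := by positivity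
      linarith
    have hc0 : 0 ≤ c := zero_le_one.trans hc1
    refine ⟨c.toNNReal, by rwa [Real.one_le_toNNReal], fun x γ N hγ => ?_⟩
    have hγ0 : 0 < γ := zero_lt_one.trans_le hγ
    set V := dampingSpeed T P γ x (((t : ℝ) : 𝕜) • L) N with hV
    rcases eq_or_ne V ⊤ with htop | htop
    · have : (c.toNNReal : ℝ≥0∞) ≠ 0 := by
        simpa using zero_lt_one.trans_le hc1
      rw [htop, ENNReal.mul_top this]
      exact le_top
    set v := V.toReal with hv
    have hv0 : 0 ≤ v := ENNReal.toReal_nonneg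
    have h1 : ∀ n (r : ℝ≥0), (N (n + 1) : ℝ≥0) ≤ r →
        ‖T r (((L * P) ^ n) x) - P (((L * P) ^ n) x)‖ ≤ ‖L‖ ^ n * v := fun n r hr => by
      have := ENNReal.toReal_mono (ENNReal.mul_ne_top (ENNReal.pow_ne_top enorm_ne_top) htop)
        (enorm_apply_sub_le_dampingSpeed T P L ht γ x N n hr)
      simpa using this
    have h2 : ∀ n, N (n + 1) * ‖x‖ ≤ γ * v := fun n => by
      have := ENNReal.toReal_mono (ENNReal.mul_ne_top ENNReal.coe_ne_top htop)
        (natCast_mul_enorm_le_dampingSpeed T P (((t : ℝ) : 𝕜) • L) hγ x N n)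
      simpa using this
    have hI : ∀ n, mixingIntegral (fun s => T (γ * s)) P (((L * P) ^ n) x) t ≤
        ‖L‖ ^ n * (((t : ℝ) + 2) * v) := fun n =>
      mixingIntegral_scale_le hT0 hT hP hγ0 x n _ hv0 (h1 n) (h2 n) t.coe_nonneg
    have b1 : ‖T (γ * t) x - P x‖ ≤ (1 + 2 / t) * v :=
      norm_apply_mul_sub_limit_le hT hP hγ0 x (N 1) hv0 (fun r hr => by simpa using h1 0 r hr)
        (h2 0) ht
    have b2 : mixingIntegral (fun s => T (γ * s)) P x t ≤ ((t : ℝ) + 2) * v := by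
      simpa using hI 0
    have b3 : mixingSeries (fun s => T (γ * s)) P L x t ≤ κ * v := by
      rw [hκ, ← tsum_mul_right]
      refine (summable_mixingSeries (hT0.scale γ) (fun s => hT (γ * s))
        (tendsto_apply_const_mul hP hγ0) L x t.coe_nonneg).tsum_le_tsum (fun n => ?_)
        (hsum.mul_right v)
      rw [mul_assoc, mul_assoc]
      gcongr
      exact hI (n + 1)
    have hfin : ‖S γ t x - NormedSpace.exp (((t : ℝ) : 𝕜) • (P * L * P)) (P x)‖ ≤ c * v := by
      refine (master γ hγ0 x).trans ?_
      calc _ ≤ (1 + 2 / t) * v + κ * v +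
            ‖L‖ * (Real.exp (‖L‖ * t) * ((t + 2) * v + κ * v * t)) := by gcongr
        _ = c * v := by rw [hc]; ring
    change ‖S γ t x - NormedSpace.exp (((t : ℝ) : 𝕜) • (P * L * P)) (P x)‖ₑ ≤ _
    rw [← ofReal_norm]
    calc ENNReal.ofReal _ ≤ ENNReal.ofReal (c * v) := ENNReal.ofReal_le_ofReal hfin
      _ = c.toNNReal * V := by
        rw [ENNReal.ofReal_mul hc0, hv, ENNReal.ofReal_toReal htop]
        rfl
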